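/- Let $\mathbf{k}$ be a field of any characteristic, let $n\ge 0$, and let $R=\mathbf{k}[[x_1,\dots,x_n]]$. Let $\Gamma=\mathbf{k}_{DP}[y_1,\dots,y_n]$ be the divided power ring, that is, the $\mathbf{k}$-vector space with basis the monomials $y^\beta$, $\beta\in\mathbb{N}^n$, regarded as an $R$-module by contraction: $x^\alpha\circ y^\beta=y^{\beta-\alpha}$ if $\alpha_i\le\beta_i$ for all $i$, and $x^\alpha\circ y^\beta=0$ otherwise, extended $\mathbf{k}$-linearly to $\Gamma$ and to infinite sums $f=\sum_\alpha f_\alpha x^\alpha\in R$ (only finitely many terms act non-trivially on a given element of $\Gamma$). For an ideal $I\subseteq R$ let $I^{\perp}=\{F\in\Gamma \mid f\circ F=0 \text{ for all } f\in I\}$, an $R$-submodule of $\Gamma$. An $R$-module $M$ is called almost finitely generated if $M$ is not finitely generated but every proper $R$-submodule of $M$ is finitely generated. Let $I$ be an ideal of $R$ such that the Krull dimension of $R/I$ is $1$. Then the following conditions are equivalent: (i) $I$ is a radical ideal; (ii) there exist finitely many almost finitely generated $R$-submodules $M_1,\dots,M_r$ of $I^{\perp}$ such that $I^{\perp}=M_1+\cdots+M_r$.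 -/

import Mathlib

/-- The underlying module of the divided power ring `Γ = k_DP[y₁, …, yₙ]`: the `k`-vector space
with basis the (divided power) monomials `y^β`, `β ∈ ℕⁿ`, where `y^β` is
`Finsupp.single β 1`. -/
def DividedPowerModule (k : Type*) [Field k] (n : ℕ) : Type _ :=
  (Fin n →₀ ℕ) →₀ k

namespace DividedPowerModule

noncomputable section

variable {k : Type*} [Field k] {n : ℕ}

instance : AddCommGroup (DividedPowerModule k n) :=
  inferInstanceAs (AddCommGroup ((Fin n →₀ ℕ) →₀ k))

instance : Module k (DividedPowerModule k n) :=
  inferInstanceAs (Module k ((Fin n →₀ ℕ) →₀ k))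

/-- The element `c y^β` of `Γ`. -/
def monomial (β : Fin n →₀ ℕ) : k →ₗ[k] DividedPowerModule k n :=
  Finsupp.lsingle (R := k) (M := k) β

/-- Contraction by the power series `f = ∑ f_α x^α`: the `k`-linear map on `Γ` with
`f ∘ y^β = ∑_{α + γ = β} f_α y^γ`, that is, `∑_{α ≤ β} f_α y^(β - α)`. -/
def contract (f : MvPowerSeries (Fin n) k) :
    DividedPowerModule k n →ₗ[k] DividedPowerModule k n :=
  Finsupp.lsum (R := k) (M := k) (N := DividedPowerModule k n) k fun β =>
    ∑ p ∈ Finset.HasAntidiagonal.antidiagonal β, MvPowerSeries.coeff p.1 f • monomial p.2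

theorem contract_monomial (f : MvPowerSeries (Fin n) k) (β : Fin n →₀ ℕ) (c : k) :
    contract f (monomial β c) =
      ∑ p ∈ Finset.HasAntidiagonal.antidiagonal β, MvPowerSeries.coeff p.1 f • monomial p.2 c := by
  refine (Finsupp.lsum_single (R := k) (M := k) (N := DividedPowerModule k n) k _ β c).trans ?_
  simp [LinearMap.sum_apply]

theorem hom_ext {φ ψ : DividedPowerModule k n →ₗ[k] DividedPowerModule k n}
    (h : ∀ β c, φ (monomial β c) = ψ (monomial β c)) : φ = ψ :=
  Finsupp.lhom_ext (R := k) (M := k) (N := DividedPowerModule k n) h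

theorem contract_one : contract (1 : MvPowerSeries (Fin n) k) = LinearMap.id := by
  refine hom_ext fun β c => ?_
  classical
  rw [contract_monomial, Finset.sum_eq_single (0, β)]
  · simp
  · rintro ⟨a, b⟩ hab hne
    have ha : a ≠ 0 := by
      rintro rfl
      exact hne (by simpa using hab)
    simp [MvPowerSeries.coeff_one, ha]
  · simp

theorem contract_add (f g : MvPowerSeries (Fin n) k) :
    contract (f + g) = contract f + contract g := by
  refine hom_ext fun β c => ?_
  simp [contract_monomial, add_smul, Finset.sum_add_distrib]

theorem contract_zero : contract (0 : MvPowerSeries (Fin n) k) = 0 := by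
  refine hom_ext fun β c => ?_
  simp [contract_monomial]

theorem contract_mul (f g : MvPowerSeries (Fin n) k) :
    contract (f * g) = contract f ∘ₗ contract g := by
  refine hom_ext fun β c => ?_
  classical
  rw [mul_comm f g]
  simp only [LinearMap.comp_apply, contract_monomial, map_sum, map_smul, MvPowerSeries.coeff_mul,
    Finset.sum_smul, Finset.smul_sum, smul_smul]
  simp only [Finset.sum_sigma']
  refine Finset.sum_nbij' (fun x => ⟨(x.2.1, x.2.2 + x.1.2), (x.2.2, x.1.2)⟩)
    (fun x => ⟨(x.1.1 + x.2.1, x.2.2), (x.1.1, x.2.1)⟩) ?_ ?_ ?_ ?_ ?_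
  · rintro ⟨⟨i, j⟩, ⟨a, b⟩⟩ h
    simp only [Finset.mem_sigma, Finset.HasAntidiagonal.mem_antidiagonal] at h ⊢
    exact ⟨by rw [← add_assoc, h.2, h.1], trivial⟩
  · rintro ⟨⟨i, j⟩, ⟨a, b⟩⟩ h
    simp only [Finset.mem_sigma, Finset.HasAntidiagonal.mem_antidiagonal] at h ⊢
    exact ⟨by rw [add_assoc, h.2, h.1], trivial⟩
  · rintro ⟨⟨i, j⟩, ⟨a, b⟩⟩ h
    simp only [Finset.mem_sigma, Finset.HasAntidiagonal.mem_antidiagonal] at h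
    obtain ⟨-, rfl⟩ := h
    rfl
  · rintro ⟨⟨i, j⟩, ⟨a, b⟩⟩ h
    simp only [Finset.mem_sigma, Finset.HasAntidiagonal.mem_antidiagonal] at h
    obtain ⟨-, rfl⟩ := h
    rfl
  · rintro ⟨⟨i, j⟩, ⟨a, b⟩⟩ h
    rfl

/-- `Γ` is a module over `R = k[[x₁, …, xₙ]]` by contraction. -/
instance : Module (MvPowerSeries (Fin n) k) (DividedPowerModule k n) where
  smul f F := contract f F
  one_smul F := congrArg (fun φ => φ F) contract_one
  mul_smul f g F := congrArg (fun φ => φ F) (contract_mul f g)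
  smul_zero f := map_zero (contract f)
  smul_add f := map_add (contract f)
  add_smul f g F := congrArg (fun φ => φ F) (contract_add f g)
  zero_smul F := congrArg (fun φ => φ F) contract_zero

end

end DividedPowerModule

/-- Macaulay's inverse system `I^⊥ = {F ∈ Γ | f ∘ F = 0 for all f ∈ I}` of an ideal `I` of
`R = k[[x₁, …, xₙ]]`, an `R`-submodule of `Γ`. -/
noncomputable def inverseSystem {k : Type*} [Field k] {n : ℕ} (I : Ideal (MvPowerSeries (Fin n) k)) :
    Submodule (MvPowerSeries (Fin n) k) (DividedPowerModule k n) :=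
  Submodule.torsionBySet (MvPowerSeries (Fin n) k) (DividedPowerModule k n) I

/-- An `A`-module `M` is almost finitely generated if it is not finitely generated, but every
proper submodule of it is. -/
structure IsAlmostFinitelyGenerated (A M : Type*) [CommRing A] [AddCommGroup M] [Module A M] :
    Prop where
  not_finite : ¬ Module.Finite A M
  fg_of_ne_top : ∀ N : Submodule A M, N ≠ ⊤ → N.FG

/-! The proof is Macaulay duality: `I ↦ I^⊥` and `N ↦ Ann N` are mutually inverse, order-reversing
bijections between ideals of `R` and submodules of `Γ` (`inverseSystem_annihilator`,
`annihilator_inverseSystem`), so sums of submodules correspond to intersections of ideals. Moreover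
`N ⊆ Γ` is finitely generated exactly when a power of every variable kills it.

If `I` is radical, it is the intersection of its finitely many minimal primes `P`. Since `dim R/I =
1`, the maximal ideal is the only prime strictly above `P`, and `P` is not maximal. A proper
submodule of `P^⊥` has annihilator strictly above `P`, so it is finitely generated, while `P^⊥` is
not. Conversely, almost finitely generated modules have prime annihilators, so (ii) writes `I` as an
intersection of primes. -/

section AlmostFinitelyGenerated

/-- The annihilator of an almost finitely generated module is a prime ideal. -/
theorem IsAlmostFinitelyGenerated.isPrime_annihilator {A M : Type*} [CommRing A] [AddCommGroup M]
    [Module A M] (h : IsAlmostFinitelyGenerated A M) : (Module.annihilator A M).IsPrime := by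
  -- Each `f` acts as zero or surjectively: otherwise its kernel and image are both proper, hence
  -- finitely generated, and so is `M`.
  have key : ∀ f : A, f ∉ Module.annihilator A M →
      LinearMap.range (LinearMap.lsmul A M f) = ⊤ := by
    intro f hf
    by_contra hne
    refine h.not_finite ⟨Submodule.fg_of_fg_map_of_fg_inf_ker (LinearMap.lsmul A M f) ?_ ?_⟩
    · rw [Submodule.map_top]
      exact h.fg_of_ne_top _ hne
    · rw [top_inf_eq]
      refine h.fg_of_ne_top _ fun hker => hf ?_
      rw [Module.mem_annihilator]
      intro m
      have hm : m ∈ LinearMap.ker (LinearMap.lsmul A M f) := hker ▸ Submodule.mem_top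
      simpa using hm
  refine ⟨fun htop => h.not_finite ?_, fun {f g} hfg => ?_⟩
  · have : Subsingleton M := Module.annihilator_eq_top_iff.mp htop
    infer_instance
  · by_contra! hcon
    obtain ⟨hf, hg⟩ := hcon
    refine hf (Module.mem_annihilator.mpr fun m => ?_)
    have hm : m ∈ LinearMap.range (LinearMap.lsmul A M g) := key g hg ▸ Submodule.mem_top
    obtain ⟨m', rfl⟩ := hm
    rw [LinearMap.lsmul_apply, smul_smul]
    exact Module.mem_annihilator.mp hfg m'

end AlmostFinitelyGenerated

/-! ### Power series and powers of the variables -/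

namespace MvPowerSeries

variable {σ R : Type*} [CommRing R]

/-- A power series none of whose monomials has all exponents in `T` at most `s` lies in the ideal
generated by the powers `x_i^(s+1)`. -/
theorem mem_span_X_pow_of_coeff_eq_zero_on (s : ℕ) (T : Finset σ) :
    ∀ g : MvPowerSeries σ R, (∀ β : σ →₀ ℕ, (∀ i ∈ T, β i ≤ s) → coeff β g = 0) →
      g ∈ Ideal.span (Set.range fun i : σ => (X i : MvPowerSeries σ R) ^ (s + 1)) := by
  classical
  induction T using Finset.induction_on with
  | empty =>
    intro g hg
    have : g = 0 := by
      ext β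
      simpa using hg β (by simp)
    simp [this]
  | insert i T _ ih =>
    intro g hg
    -- `g₁` collects the terms divisible by `x_i^(s+1)`; the rest satisfies the hypothesis for the
    -- smaller set `T`.
    let g₁ : MvPowerSeries σ R := fun β => if s < β i then coeff β g else 0
    have hg₁ : ∀ β, coeff β g₁ = if s < β i then coeff β g else 0 := fun β => rfl
    have h₁ : g₁ ∈ Ideal.span (Set.range fun i : σ => (X i : MvPowerSeries σ R) ^ (s + 1)) := by
      refine Ideal.mem_of_dvd _ ?_ (Ideal.subset_span ⟨i, rfl⟩)
      refine X_pow_dvd_iff.mpr fun β hβ => ?_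
      rw [hg₁, if_neg (by omega)]
    have h₂ : g - g₁ ∈ Ideal.span (Set.range fun i : σ => (X i : MvPowerSeries σ R) ^ (s + 1)) := by
      refine ih _ fun β hβ => ?_
      rw [map_sub, hg₁]
      split_ifs with hi
      · exact sub_self _
      · rw [sub_zero]
        refine hg β fun j hj => ?_
        rcases Finset.mem_insert.mp hj with rfl | hj
        · omega
        · exact hβ j hj
    simpa using Ideal.add_mem _ h₂ h₁

theorem mem_span_X_pow_of_coeff_eq_zero [Fintype σ] (s : ℕ) (g : MvPowerSeries σ R)
    (hg : ∀ β : σ →₀ ℕ, (∀ i, β i ≤ s) → coeff β g = 0) :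
    g ∈ Ideal.span (Set.range fun i : σ => (X i : MvPowerSeries σ R) ^ (s + 1)) :=
  mem_span_X_pow_of_coeff_eq_zero_on s Finset.univ g fun β hβ => hg β fun i => hβ i (by simp)

variable {k : Type*} [Field k]

theorem X_mem_maximalIdeal (i : σ) :
    (X i : MvPowerSeries σ k) ∈ IsLocalRing.maximalIdeal (MvPowerSeries σ k) := by
  rw [IsLocalRing.mem_maximalIdeal, mem_nonunits_iff, isUnit_iff_constantCoeff]
  simp

theorem maximalIdeal_le_of_X_mem [Fintype σ] {J : Ideal (MvPowerSeries σ k)}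
    (hJ : ∀ i, (X i : MvPowerSeries σ k) ∈ J) :
    IsLocalRing.maximalIdeal (MvPowerSeries σ k) ≤ J := by
  intro g hg
  have h := mem_span_X_pow_of_coeff_eq_zero 0 g fun β hβ => by
    have hβ0 : β = 0 := Finsupp.ext fun i => by simpa using hβ i
    rw [IsLocalRing.mem_maximalIdeal, mem_nonunits_iff, isUnit_iff_constantCoeff] at hg
    simpa [hβ0] using hg
  refine Ideal.span_le.mpr ?_ h
  rintro _ ⟨i, rfl⟩
  simpa using hJ i

end MvPowerSeries

/-! ### The pairing of `R` with `Γ`, and finite generation in `Γ` -/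

namespace DividedPowerModule

noncomputable section

variable {k : Type*} [Field k] {n : ℕ}

local notation "𝓡" => MvPowerSeries (Fin n) k

/-- The coefficient of `y^β`. -/
def coeff (β : Fin n →₀ ℕ) : DividedPowerModule k n →ₗ[k] k :=
  Finsupp.lapply (R := k) (M := k) β

theorem ext_coeff {F G : DividedPowerModule k n} (h : ∀ β, coeff β F = coeff β G) : F = G :=
  Finsupp.ext h

theorem functional_ext {φ ψ : DividedPowerModule k n →ₗ[k] k}
    (h : ∀ β c, φ (monomial β c) = ψ (monomial β c)) : φ = ψ :=
  Finsupp.lhom_ext (R := k) (M := k) (N := k) h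

theorem coeff_monomial [DecidableEq (Fin n →₀ ℕ)] (β γ : Fin n →₀ ℕ) (c : k) :
    coeff γ (monomial β c) = if β = γ then c else 0 :=
  (Finsupp.single_apply (a := β) (a' := γ) (b := c))

theorem smul_def (f : 𝓡) (F : DividedPowerModule k n) : f • F = contract f F := rfl

theorem contract_C (c : k) :
    contract (MvPowerSeries.C c : 𝓡) = c • LinearMap.id := by
  classical
  refine hom_ext fun β d => ?_
  rw [contract_monomial, Finset.sum_eq_single (0, β)]
  · simp
  · rintro ⟨a, b⟩ hab hne
    have ha : a ≠ 0 := by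
      rintro rfl
      exact hne (by simpa using hab)
    simp [MvPowerSeries.coeff_C, ha]
  · simp

theorem C_smul (c : k) (F : DividedPowerModule k n) : (MvPowerSeries.C c : 𝓡) • F = c • F := by
  rw [smul_def, contract_C]
  rfl

/-- The pairing `(f, F) ↦ coeff 0 (f • F)` makes the monomials `x^β` and `y^β` dual to each other.
-/
theorem coeff_zero_smul_monomial (f : 𝓡) (β : Fin n →₀ ℕ) (c : k) :
    coeff 0 (f • monomial β c) = MvPowerSeries.coeff β f * c := by
  classical
  rw [smul_def, contract_monomial, map_sum, Finset.sum_eq_single (β, 0)]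
  · simp [coeff_monomial]
  · rintro ⟨a, b⟩ hab hne
    have hb : b ≠ 0 := by
      rintro rfl
      exact hne (by simpa using hab)
    simp [coeff_monomial, hb]
  · simp

theorem coeff_zero_monomial_smul (γ : Fin n →₀ ℕ) (F : DividedPowerModule k n) :
    coeff 0 ((MvPowerSeries.monomial γ 1 : 𝓡) • F) = coeff γ F := by
  classical
  have h : (coeff 0 : DividedPowerModule k n →ₗ[k] k) ∘ₗ contract (MvPowerSeries.monomial γ 1 : 𝓡) =
      coeff γ := by
    refine functional_ext fun β c => ?_
    rw [LinearMap.comp_apply, ← smul_def, coeff_zero_smul_monomial, coeff_monomial,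
      MvPowerSeries.coeff_monomial]
    split_ifs <;> simp
  exact congrArg (fun ψ : DividedPowerModule k n →ₗ[k] k => ψ F) h

/-- Reduces `f • F = 0` to the vanishing of the pairing of `F` with the multiples `x^γ f`. -/
theorem coeff_smul (γ : Fin n →₀ ℕ) (f : 𝓡) (F : DividedPowerModule k n) :
    coeff γ (f • F) = coeff 0 ((MvPowerSeries.monomial γ 1 * f) • F) := by
  rw [mul_smul, coeff_zero_monomial_smul]

/-- Every linear functional on `Γ` is given by pairing with a power series. -/
theorem exists_eq_coeff_zero_smul (φ : DividedPowerModule k n →ₗ[k] k) :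
    ∃ f : 𝓡, ∀ F, φ F = coeff 0 (f • F) := by
  let f : 𝓡 := fun β => φ (monomial β 1)
  refine ⟨f, fun F => ?_⟩
  have h : φ = (coeff 0 : DividedPowerModule k n →ₗ[k] k) ∘ₗ contract f := by
    refine functional_ext fun β c => ?_
    rw [LinearMap.comp_apply, ← smul_def, coeff_zero_smul_monomial]
    change _ = φ (monomial β 1) * c
    rw [mul_comm, ← smul_eq_mul c, ← map_smul, ← map_smul, smul_eq_mul, mul_one]
  exact congrArg (fun ψ : DividedPowerModule k n →ₗ[k] k => ψ F) h

theorem eq_sum_monomial (F : DividedPowerModule k n) (S : Finset (Fin n →₀ ℕ))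
    (hS : ∀ β, β ∉ S → coeff β F = 0) : F = ∑ β ∈ S, monomial β (coeff β F) := by
  classical
  refine ext_coeff fun γ => ?_
  rw [map_sum]
  simp only [coeff_monomial, Finset.sum_ite_eq']
  split_ifs with h
  · rfl
  · exact hS γ h

/-- `x_i^(d+1)` kills an element of degree at most `d`. -/
theorem exists_X_pow_smul_eq_zero (i : Fin n) (F : DividedPowerModule k n) :
    ∃ s : ℕ, (MvPowerSeries.X i ^ s : 𝓡) • F = 0 := by
  classical
  let S : Finset (Fin n →₀ ℕ) := Finsupp.support (M := k) F
  refine ⟨S.sup (fun β => β i) + 1, ext_coeff fun γ => ?_⟩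
  rw [coeff_smul, MvPowerSeries.X_pow_eq, MvPowerSeries.monomial_mul_monomial, one_mul,
    coeff_zero_monomial_smul, map_zero]
  by_contra hne
  have hmem : γ + Finsupp.single i (S.sup (fun β => β i) + 1) ∈ S :=
    Finsupp.mem_support_iff.mpr hne
  have := Finset.le_sup (f := fun β : Fin n →₀ ℕ => β i) hmem
  simp only [Finsupp.add_apply, Finsupp.single_eq_same] at this
  omega

/-- A finitely generated submodule of `Γ` is killed by a power of every variable. -/
theorem exists_X_pow_mem_annihilator {N : Submodule 𝓡 (DividedPowerModule k n)} (hN : N.FG)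
    (i : Fin n) : ∃ s : ℕ, (MvPowerSeries.X i ^ s : 𝓡) ∈ N.annihilator := by
  classical
  obtain ⟨S, rfl⟩ := hN
  choose s hs using fun F : DividedPowerModule k n => exists_X_pow_smul_eq_zero i F
  refine ⟨S.sup s, ?_⟩
  rw [Submodule.mem_annihilator_span]
  rintro ⟨F, hF⟩
  obtain ⟨t, ht⟩ := Nat.exists_eq_add_of_le (Finset.le_sup (f := s) hF)
  rw [ht, add_comm, pow_add, mul_smul]
  change _ • (MvPowerSeries.X i ^ s F : 𝓡) • F = 0
  rw [hs, smul_zero]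

/-- A submodule of `Γ` killed by a power of every variable is finitely generated. -/
theorem fg_of_X_pow_mem_annihilator {N : Submodule 𝓡 (DividedPowerModule k n)}
    (hN : ∀ i, ∃ s : ℕ, (MvPowerSeries.X i ^ s : 𝓡) ∈ N.annihilator) : N.FG := by
  classical
  choose s hs using hN
  let S : Finset (Fin n →₀ ℕ) := Finset.Iic (Finsupp.equivFunOnFinite.symm s)
  let B : Finset (DividedPowerModule k n) := S.image fun β => monomial β 1
  have hle : N ≤ Submodule.span 𝓡 (B : Set (DividedPowerModule k n)) := by
    intro F hF
    have hzero : ∀ β, β ∉ S → coeff β F = 0 := by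
      intro β hβ
      have : ∃ i, s i < β i := by
        by_contra! hcon
        exact hβ (Finset.mem_Iic.mpr fun i => by simpa using hcon i)
      obtain ⟨i, hi⟩ := this
      have hsplit : β = (β - Finsupp.single i (s i)) + Finsupp.single i (s i) := by
        refine (tsub_add_cancel_of_le ?_).symm
        rw [Finsupp.single_le_iff]
        exact hi.le
      have hX : (MvPowerSeries.X i ^ s i : 𝓡) • F = 0 := Submodule.mem_annihilator.mp (hs i) F hF
      rw [← coeff_zero_monomial_smul, hsplit, ← one_mul (1 : k),
        ← MvPowerSeries.monomial_mul_monomial, mul_smul, ← MvPowerSeries.X_pow_eq, hX]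
      simp
    rw [eq_sum_monomial F S hzero]
    refine Submodule.sum_mem _ fun β hβ => ?_
    have : monomial β (coeff β F) = (MvPowerSeries.C (coeff β F) : 𝓡) • monomial β (1 : k) := by
      rw [C_smul, ← map_smul, smul_eq_mul, mul_one]
    rw [this]
    exact Submodule.smul_mem _ _ (Submodule.subset_span (Finset.mem_image_of_mem _ hβ))
  -- `R` is Noetherian, so a submodule of the span of finitely many monomials is finitely generated.
  exact Submodule.FG.of_le (Submodule.fg_span B.finite_toSet) hle

end

end DividedPowerModule

/-! ### Macaulay duality -/

section InverseSystem

open DividedPowerModule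

variable {k : Type*} [Field k] {n : ℕ}

theorem mem_inverseSystem {I : Ideal (MvPowerSeries (Fin n) k)} {F : DividedPowerModule k n} :
    F ∈ inverseSystem I ↔ ∀ f ∈ I, f • F = 0 := by
  rw [inverseSystem, Submodule.mem_torsionBySet_iff]
  simp

theorem inverseSystem_antitone {I J : Ideal (MvPowerSeries (Fin n) k)} (h : I ≤ J) :
    inverseSystem J ≤ inverseSystem I :=
  fun _ hF => mem_inverseSystem.mpr fun f hf => mem_inverseSystem.mp hF f (h hf)

/-- Every submodule of `Γ` is the inverse system of its annihilator. -/
theorem inverseSystem_annihilator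
    (N : Submodule (MvPowerSeries (Fin n) k) (DividedPowerModule k n)) :
    inverseSystem N.annihilator = N := by
  refine le_antisymm (fun G hG => ?_) fun F hF =>
    mem_inverseSystem.mpr fun f hf => Submodule.mem_annihilator.mp hf F hF
  by_contra hGN
  let N' : Submodule k (DividedPowerModule k n) :=
    { carrier := N
      add_mem' := N.add_mem
      zero_mem' := N.zero_mem
      smul_mem' := fun c F hF => by
        rw [← C_smul]
        exact N.smul_mem _ hF }
  -- A functional separating `G` from `N` is pairing with some `f`. Since `N` is stable under every
  -- `x^γ`, this `f` annihilates `N`, hence also `G`.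
  obtain ⟨φ, hφG, hφN⟩ := Submodule.exists_le_ker_of_notMem (p := N') (v := G) hGN
  obtain ⟨f, hf⟩ := exists_eq_coeff_zero_smul φ
  have hfN : f ∈ N.annihilator := by
    refine Submodule.mem_annihilator.mpr fun F hF => ext_coeff fun γ => ?_
    rw [coeff_smul, mul_comm, mul_smul, ← hf, map_zero]
    exact hφN (N.smul_mem _ hF)
  refine hφG ?_
  rw [hf, mem_inverseSystem.mp hG f hfN, map_zero]

/-- Every ideal of `R` is the annihilator of its inverse system. -/
theorem annihilator_inverseSystem (I : Ideal (MvPowerSeries (Fin n) k)) :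
    (inverseSystem I).annihilator = I := by
  classical
  refine le_antisymm (fun f hf => ?_) fun f hf =>
    Submodule.mem_annihilator.mpr fun F hF => mem_inverseSystem.mp hF f hf
  by_contra hfI
  let m := IsLocalRing.maximalIdeal (MvPowerSeries (Fin n) k)
  -- Krull's intersection theorem: `R/I` is `m`-adically separated.
  obtain ⟨s, hs⟩ : ∃ s : ℕ, f ∉ I ⊔ m ^ s := by
    by_contra! hcon
    refine hfI (Ideal.Quotient.eq_zero_iff_mem.mp ?_)
    refine (IsHausdorff.of_isLocalRing m (MvPowerSeries (Fin n) k ⧸ I)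
      (IsLocalRing.maximalIdeal.isMaximal _).ne_top).haus' _ fun s => ?_
    rw [SModEq.zero]
    obtain ⟨a, ha, b, hb, rfl⟩ := Submodule.mem_sup.mp (hcon s)
    rw [map_add, Ideal.Quotient.eq_zero_iff_mem.mpr ha, zero_add]
    have : Ideal.Quotient.mk I b = b • (1 : MvPowerSeries (Fin n) k ⧸ I) :=
      Algebra.algebraMap_eq_smul_one (A := MvPowerSeries (Fin n) k ⧸ I) b
    rw [this]
    exact Submodule.smul_mem_smul hb Submodule.mem_top
  obtain ⟨φ, hφf, hφ⟩ := Submodule.exists_le_ker_of_notMem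
    (p := (I ⊔ m ^ s).restrictScalars k) (v := f) hs
  let S : Finset (Fin n →₀ ℕ) := Finset.Iic (Finsupp.equivFunOnFinite.symm fun _ => s)
  -- `φ` kills `m ^ s`, so it depends only on the coefficients in the finite box `S`; hence it is
  -- pairing with an honest element of `Γ`.
  let F : DividedPowerModule k n := ∑ β ∈ S, monomial β (φ (MvPowerSeries.monomial β 1))
  have hpair : ∀ g : MvPowerSeries (Fin n) k, coeff 0 (g • F) = φ g := by
    intro g
    have hmem : g - ∑ β ∈ S, MvPowerSeries.monomial β (MvPowerSeries.coeff β g) ∈ m ^ s := by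
      have hspan := MvPowerSeries.mem_span_X_pow_of_coeff_eq_zero s
        (g - ∑ β ∈ S, MvPowerSeries.monomial β (MvPowerSeries.coeff β g)) fun γ hγ => by
          have hγS : γ ∈ S := Finset.mem_Iic.mpr fun i => by simpa using hγ i
          simp only [map_sub, map_sum, MvPowerSeries.coeff_monomial, Finset.sum_ite_eq, hγS,
            if_true, sub_self]
      refine Ideal.span_le.mpr ?_ hspan
      rintro _ ⟨i, rfl⟩
      exact Ideal.pow_le_pow_right (Nat.le_succ s)
        (Ideal.pow_mem_pow (MvPowerSeries.X_mem_maximalIdeal i) _)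
    have hφg := hφ (show _ ∈ (I ⊔ m ^ s).restrictScalars k from
      (le_sup_right : m ^ s ≤ I ⊔ m ^ s) hmem)
    rw [LinearMap.mem_ker, map_sub, sub_eq_zero] at hφg
    rw [hφg, Finset.smul_sum, map_sum, map_sum]
    refine Finset.sum_congr rfl fun β _ => ?_
    rw [coeff_zero_smul_monomial, ← smul_eq_mul, ← map_smul, ← map_smul, smul_eq_mul, mul_one]
  have hF : F ∈ inverseSystem I := by
    refine mem_inverseSystem.mpr fun g hg => ext_coeff fun γ => ?_
    rw [coeff_smul, hpair, map_zero]
    exact hφ (show _ ∈ (I ⊔ m ^ s).restrictScalars k from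
      (le_sup_left : I ≤ I ⊔ m ^ s) (I.mul_mem_left _ hg))
  refine hφf ?_
  rw [← hpair, Submodule.mem_annihilator.mp hf F hF, map_zero]

/-- If `P` is a non-maximal prime ideal such that every strictly larger prime is maximal, then
`P^⊥` is almost finitely generated. -/
theorem isAlmostFinitelyGenerated_inverseSystem {P : Ideal (MvPowerSeries (Fin n) k)}
    (hP : P.IsPrime) (hne : P ≠ IsLocalRing.maximalIdeal _)
    (hmax : ∀ Q : Ideal (MvPowerSeries (Fin n) k), Q.IsPrime → P < Q →
      Q = IsLocalRing.maximalIdeal _) :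
    IsAlmostFinitelyGenerated (MvPowerSeries (Fin n) k) (inverseSystem P) := by
  refine ⟨fun hfin => ?_, fun N hN => ?_⟩
  · have hfg := Module.Finite.iff_fg.mp hfin
    refine hne (le_antisymm (IsLocalRing.le_maximalIdeal hP.ne_top)
      (MvPowerSeries.maximalIdeal_le_of_X_mem fun i => ?_))
    obtain ⟨s, hs⟩ := exists_X_pow_mem_annihilator hfg i
    rw [annihilator_inverseSystem] at hs
    exact hP.mem_of_pow_mem s hs
  · let N' := N.map (inverseSystem P).subtype
    have hN'le : N' ≤ inverseSystem P := Submodule.map_subtype_le _ _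
    suffices h : N'.FG from
      Submodule.fg_of_fg_map_injective _ (inverseSystem P).injective_subtype h
    have hPN : P ≤ N'.annihilator := by
      rw [← annihilator_inverseSystem P]
      exact Submodule.annihilator_mono hN'le
    refine fg_of_X_pow_mem_annihilator fun i => ?_
    -- It suffices that `x_i` lies in every prime `Q` over the annihilator. By duality `Q = P` would
    -- force `N' = P^⊥`, so `Q` is maximal.
    change _ ∈ N'.annihilator.radical
    rw [Ideal.radical_eq_sInf, Submodule.mem_sInf]
    rintro Q ⟨hQ, hQp⟩
    have hlt : P < Q := by
      refine lt_of_le_of_ne (hPN.trans hQ) ?_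
      rintro rfl
      have hann : N'.annihilator = P := le_antisymm hQ hPN
      have hN' : N' = inverseSystem P := by rw [← hann, inverseSystem_annihilator]
      refine hN (Submodule.map_injective_of_injective (inverseSystem P).injective_subtype ?_)
      rw [Submodule.map_top, Submodule.range_subtype]
      exact hN'
    rw [hmax Q hQp hlt]
    exact MvPowerSeries.X_mem_maximalIdeal i

end InverseSystem

/-! ### Primes over an ideal with one-dimensional quotient -/

section KrullDimension

variable {A : Type*} [CommRing A] [IsLocalRing A] {I P : Ideal A}

theorem ne_maximalIdeal_of_mem_minimalPrimes (hI : 1 ≤ ringKrullDim (A ⧸ I))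
    (hP : P ∈ I.minimalPrimes) : P ≠ IsLocalRing.maximalIdeal A := by
  rintro rfl
  rw [ringKrullDim_quotient, Order.one_le_krullDim_iff] at hI
  obtain ⟨⟨x, hx⟩, ⟨y, hy⟩, hxy⟩ := hI
  have hxy' : x.asIdeal < y.asIdeal := hxy
  have hle := hP.2 ⟨x.isPrime, hx⟩ (IsLocalRing.le_maximalIdeal x.isPrime.ne_top)
  exact (hxy'.trans_le (IsLocalRing.le_maximalIdeal y.isPrime.ne_top)).not_ge hle

theorem eq_maximalIdeal_of_lt (hI : ringKrullDim (A ⧸ I) ≤ 1) (hIP : I ≤ P) (hP : P.IsPrime)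
    {Q : Ideal A} (hQ : Q.IsPrime) (hPQ : P < Q) : Q = IsLocalRing.maximalIdeal A := by
  by_contra hne
  have hQm : Q < IsLocalRing.maximalIdeal A :=
    lt_of_le_of_ne (IsLocalRing.le_maximalIdeal hQ.ne_top) hne
  let p : PrimeSpectrum.zeroLocus (I : Set A) := ⟨⟨P, hP⟩, hIP⟩
  let q : PrimeSpectrum.zeroLocus (I : Set A) := ⟨⟨Q, hQ⟩, hIP.trans hPQ.le⟩
  let m : PrimeSpectrum.zeroLocus (I : Set A) :=
    ⟨⟨IsLocalRing.maximalIdeal A, inferInstance⟩, (hIP.trans hPQ.le).trans hQm.le⟩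
  have hpq : p < q := hPQ
  have hqm : q < m := hQm
  let l : LTSeries (PrimeSpectrum.zeroLocus (I : Set A)) :=
    { length := 2
      toFun := ![p, q, m]
      step := fun i => by
        fin_cases i
        · exact hpq
        · exact hqm }
  have hl := Order.LTSeries.length_le_krullDim l
  rw [← ringKrullDim_quotient] at hl
  have h2 : ((2 : ℕ) : WithBot ℕ∞) ≤ ((1 : ℕ) : WithBot ℕ∞) := hl.trans hI
  exact absurd (by exact_mod_cast h2 : 2 ≤ 1) (by norm_num)

end KrullDimension

theorem isRadical_iInf {A ι : Type*} [CommRing A] {P : ι → Ideal A} (h : ∀ i, (P i).IsRadical) :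
    (⨅ i, P i).IsRadical := by
  rintro f ⟨s, hs⟩
  rw [Submodule.mem_iInf] at hs ⊢
  exact fun i => h i ⟨s, hs i⟩

theorem proposition5p1 {k : Type*} [Field k] (n : ℕ) (I : Ideal (MvPowerSeries (Fin n) k))
    (hI : ringKrullDim (MvPowerSeries (Fin n) k ⧸ I) = 1) :
    I.IsRadical ↔
      ∃ (r : ℕ) (M : Fin r → Submodule (MvPowerSeries (Fin n) k) (DividedPowerModule k n)),
        (∀ i, M i ≤ inverseSystem I ∧
          IsAlmostFinitelyGenerated (MvPowerSeries (Fin n) k) (M i)) ∧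
        inverseSystem I = ⨆ i, M i := by

  constructor
  · intro hrad
    have hfin : I.minimalPrimes.Finite :=
      I.finite_minimalPrimes_of_isNoetherianRing (MvPowerSeries (Fin n) k)
    obtain ⟨r, P, -, hP⟩ := hfin.fin_param
    have hmem : ∀ i, P i ∈ I.minimalPrimes := fun i => hP ▸ Set.mem_range_self i
    have hinf : ⨅ i, P i = I := by
      rw [iInf, hP, Ideal.sInf_minimalPrimes, hrad.radical]
    refine ⟨r, fun i => inverseSystem (P i), fun i => ⟨inverseSystem_antitone (hmem i).1.2,
      isAlmostFinitelyGenerated_inverseSystem (hmem i).1.1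
        (ne_maximalIdeal_of_mem_minimalPrimes hI.ge (hmem i))
        fun Q hQ hlt => eq_maximalIdeal_of_lt hI.le (hmem i).1.2 (hmem i).1.1 hQ hlt⟩, ?_⟩
    -- By duality it is enough to compare annihilators, where the sum becomes `⨅ i, P i`.
    rw [← inverseSystem_annihilator (⨆ i, inverseSystem (P i)), Submodule.annihilator_iSup]
    simp only [annihilator_inverseSystem, hinf]
  · rintro ⟨r, M, hM, hsup⟩
    rw [← annihilator_inverseSystem I, hsup, Submodule.annihilator_iSup]
    exact isRadical_iInf fun i => (hM i).2.isPrime_annihilator.isRadical
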